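/- Let $n\ge 1$ and $s\in(0,1)$. Let $\phi:\mathbb{R}^n\to\mathbb{R}^n$ be a global $C^\infty$-diffeomorphism (bijective and smooth with smooth inverse), with $|J_\phi(x)|=|\det D\phi(x)|$, and let $\omega:\mathbb{R}^n\to\mathbb{C}$ be a nowhere vanishing $C^\infty$ function. Let $\mathcal{S}_{\phi,\omega}(\mathbb{R}^n)$ be the set of all $f:\mathbb{R}^n\to\mathbb{C}$ such that $(\omega f)\circ\phi^{-1}$ belongs to the classical Schwartz space $\mathcal{S}(\mathbb{R}^n)$. Put $$[\mathcal{F}_{\phi,\omega}f](\xi)=\frac{1}{(2\pi)^{n/2}}\int_{\mathbb{R}^n}e^{-i\xi\cdot\phi(x)}\,\omega(x)f(x)\,|J_\phi(x)|\,dx,\qquad [\mathcal{F}_{\phi,\omega}^{-1}F](x)=\frac{1}{\omega(x)(2\pi)^{n/2}}\int_{\mathbb{R}^n}e^{i\xi\cdot\phi(x)}F(\xi)\,d\xi,$$ and define the weighted fractional Laplacian spectrally by $(-\Delta_{\phi,\omega})^s f=\mathcal{F}_{\phi,\omega}^{-1}\big[|\xi|^{2s}[\mathcal{F}_{\phi,\omega}f](\xi)\big]$.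 Theorem (Integral Representation). For every $f\in\mathcal{S}_{\phi,\omega}(\mathbb{R}^n)$ and every $x\in\mathbb{R}^n$, $$(-\Delta_{\phi,\omega})^s f(x)=\frac{C_{n,s}}{\omega(x)}\;\mathrm{P.V.}\!\int_{\mathbb{R}^n}\frac{\omega(x)f(x)-\omega(y)f(y)}{|\phi(x)-\phi(y)|^{n+2s}}\,|J_\phi(y)|\,dy,\qquad C_{n,s}=\frac{s\,4^s\,\Gamma\!\left(\frac n2+s\right)}{\pi^{n/2}\,\Gamma(1-s)},$$ where $C_{n,s}$ is the normalization constant of the classical fractional Laplacian. Here the principal value exists: the integrand is integrable over $\{y:|x-y|>\varepsilon\}$ for each $\varepsilon>0$, and $\mathrm{P.V.}\int$ is the limit of these integrals as $\varepsilon\to0^+$. The same holds, with the same limit, for the regions $\{y:|\phi(x)-\phi(y)|>\varepsilon\}$. -/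

import Mathlib

/-!
Conjugation by `φ`, that is, replacing `f` by `g = (w f) ∘ φ⁻¹` and substituting `u = φ y`, turns
both sides into their classical counterparts for `g` at `z = φ x`, except that the region
`‖x - y‖ > ε` becomes `‖φ⁻¹ (z + v) - x‖ > ε`.

Classically, the symmetric second difference of `g` is the inverse Fourier transform of
`2 (1 - cos (ξ · v)) ĝ(ξ)`, so Fubini's theorem and
`∫ (1 - cos (ξ · v)) / |v| ^ (n + 2 s) dv = |ξ| ^ (2 s) / C_{n,s}` identify half of its integral
against `|v| ^ (-n - 2 s)` with `(-Δ) ^ s g(z) / C_{n,s}`. That integral converges absolutely, so it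
is the principal value over any regions symmetric under `v ↦ -v`.

With `A = D(φ⁻¹)(z)`, the region `‖φ⁻¹ (z + v) - x‖ > ε` differs from the symmetric region
`‖A v‖ > ε` by a subset of a shell of thickness `O(ε²)`, hence of volume `O(ε ^ (n + 1))`, on which
the one-sided difference quotient is `O(ε ^ (1 - n - 2 s))`; the error is `O(ε ^ (2 - 2 s))`.
-/

open MeasureTheory Filter Topology
open scoped ContDiff SchwartzMap

noncomputable section

namespace WeightedFractional

variable {n : ℕ}

/-- The absolute value `|J_φ(x)| = |det Dφ(x)|` of the Jacobian determinant of `φ`. -/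
def absJacobian (φ : EuclideanSpace ℝ (Fin n) → EuclideanSpace ℝ (Fin n))
    (x : EuclideanSpace ℝ (Fin n)) : ℝ :=
  |(fderiv ℝ φ x).det|

/-- The generalized Schwartz space `S_{φ,w}`: all functions `f` for which
`(w f) ∘ φ⁻¹` is a classical Schwartz function. -/
def weightedSchwartz (φ : EuclideanSpace ℝ (Fin n) ≃ EuclideanSpace ℝ (Fin n))
    (w : EuclideanSpace ℝ (Fin n) → ℂ) : Set (EuclideanSpace ℝ (Fin n) → ℂ) :=
  {f | ∃ g : 𝓢(EuclideanSpace ℝ (Fin n), ℂ),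
    (g : EuclideanSpace ℝ (Fin n) → ℂ) = (fun y => w y * f y) ∘ φ.symm}

/-- The weighted Fourier transform
`(2π)^{-n/2} ∫ e^{-i ξ · φ(x)} w(x) f(x) |J_φ(x)| dx`. -/
def weightedFourier (φ : EuclideanSpace ℝ (Fin n) → EuclideanSpace ℝ (Fin n))
    (w f : EuclideanSpace ℝ (Fin n) → ℂ) (ξ : EuclideanSpace ℝ (Fin n)) : ℂ :=
  1 / (((2 * Real.pi) ^ ((n : ℝ) / 2) : ℝ) : ℂ) *
    ∫ x, Complex.exp (-Complex.I * ((inner ℝ ξ (φ x) : ℝ) : ℂ)) * w x * f x *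
      ((absJacobian φ x : ℝ) : ℂ)

/-- The inverse weighted Fourier transform
`w(x)⁻¹ (2π)^{-n/2} ∫ e^{i ξ · φ(x)} F(ξ) dξ`. -/
def weightedFourierInv (φ : EuclideanSpace ℝ (Fin n) → EuclideanSpace ℝ (Fin n))
    (w F : EuclideanSpace ℝ (Fin n) → ℂ) (x : EuclideanSpace ℝ (Fin n)) : ℂ :=
  1 / (w x * (((2 * Real.pi) ^ ((n : ℝ) / 2) : ℝ) : ℂ)) *
    ∫ ξ, Complex.exp (Complex.I * ((inner ℝ ξ (φ x) : ℝ) : ℂ)) * F ξ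

/-- The weighted fractional Laplacian `(-Δ_{φ,w})^s`, defined spectrally as the
operator with symbol `|ξ|^{2s}` under the weighted Fourier transform. -/
def weightedFracLaplacian (s : ℝ) (φ : EuclideanSpace ℝ (Fin n) → EuclideanSpace ℝ (Fin n))
    (w f : EuclideanSpace ℝ (Fin n) → ℂ) : EuclideanSpace ℝ (Fin n) → ℂ :=
  weightedFourierInv φ w
    (fun ξ => ((‖ξ‖ ^ (2 * s) : ℝ) : ℂ) * weightedFourier φ w f ξ)

/-- The normalization constant of the classical fractional Laplacian on `ℝⁿ`,
`C_{n,s} = s 4^s Γ(n/2 + s) / (π^{n/2} Γ(1 - s))`. -/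
def fracLaplacianConst (n : ℕ) (s : ℝ) : ℝ :=
  s * 4 ^ s * Real.Gamma ((n : ℝ) / 2 + s) /
    (Real.pi ^ ((n : ℝ) / 2) * Real.Gamma (1 - s))

/-- `HasPrincipalValue d F L`: the function `F` is integrable on each region `{d > ε}`, `ε > 0`,
and its integrals over these regions converge to `L` as `ε → 0⁺`.  With `d y = ‖x - y‖` this says
that the usual principal value at `x` of the integral of `F` exists and equals `L`. -/
def HasPrincipalValue (d : EuclideanSpace ℝ (Fin n) → ℝ)
    (F : EuclideanSpace ℝ (Fin n) → ℂ) (L : ℂ) : Prop :=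
  (∀ ε : ℝ, 0 < ε → IntegrableOn F {y | ε < d y}) ∧
    Tendsto (fun ε : ℝ => ∫ y in {y | ε < d y}, F y) (𝓝[>] 0) (𝓝 L)

/-- The hypersingular integrand
`(w(x) f(x) - w(y) f(y)) / |φ(x) - φ(y)|^{n+2s} · |J_φ(y)|`. -/
def hypersingularIntegrand (s : ℝ)
    (φ : EuclideanSpace ℝ (Fin n) → EuclideanSpace ℝ (Fin n))
    (w f : EuclideanSpace ℝ (Fin n) → ℂ) (x y : EuclideanSpace ℝ (Fin n)) : ℂ :=
  (w x * f x - w y * f y) / ((‖φ x - φ y‖ ^ ((n : ℝ) + 2 * s) : ℝ) : ℂ) *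
    ((absJacobian φ y : ℝ) : ℂ)

end WeightedFractional

end

namespace WeightedFractional

open Module (finrank)
open Set Asymptotics Metric
open scoped FourierTransform RealInnerProductSpace symmDiff

section GammaIntegrals

theorem lintegral_ofReal_eq_ofReal_integral {α : Type*} [MeasurableSpace α] {μ : Measure α}
    {f : α → ℝ} (hf : 0 ≤ᵐ[μ] f) (hpos : 0 < ∫ a, f a ∂μ) :
    ∫⁻ a, ENNReal.ofReal (f a) ∂μ = ENNReal.ofReal (∫ a, f a ∂μ) :=
  (ofReal_integral_eq_lintegral_ofReal (.of_integral_ne_zero hpos.ne') hf).symm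

theorem lintegral_rpow_mul_exp_neg_mul {a r : ℝ} (ha : 0 < a) (hr : 0 < r) :
    ∫⁻ t in Ioi (0 : ℝ), ENNReal.ofReal (t ^ (a - 1) * Real.exp (-(r * t))) =
      ENNReal.ofReal ((1 / r) ^ a * Real.Gamma a) := by
  have h := Real.integral_rpow_mul_exp_neg_mul_Ioi ha hr
  rw [lintegral_ofReal_eq_ofReal_integral, h]
  · filter_upwards [ae_restrict_mem measurableSet_Ioi] with t (ht : 0 < t)
    rw [Pi.zero_apply]
    positivity
  · rw [h]
    exact mul_pos (by positivity) (Real.Gamma_pos_of_pos ha)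

theorem integral_rpow_mul_exp_neg_div {a b : ℝ} (ha : 0 < a) (hb : 0 < b) :
    ∫ t in Ioi (0 : ℝ), t ^ (-a - 1) * Real.exp (-(b / t)) = b ^ (-a) * Real.Gamma a := by
  have h := Real.integral_rpow_mul_exp_neg_mul_Ioi ha hb
  rw [← integral_comp_rpow_Ioi _ (neg_ne_zero.2 one_ne_zero), one_div, Real.inv_rpow hb.le,
    ← Real.rpow_neg hb.le] at h
  rw [← h]
  refine setIntegral_congr_fun measurableSet_Ioi fun t (ht : 0 < t) => ?_
  simp only [smul_eq_mul, abs_neg, abs_one, one_mul]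
  rw [← Real.rpow_mul ht.le, ← mul_assoc, ← Real.rpow_add ht, Real.rpow_neg_one, div_eq_mul_inv]
  ring_nf

theorem lintegral_rpow_mul_exp_neg_div {a b : ℝ} (ha : 0 < a) (hb : 0 < b) :
    ∫⁻ t in Ioi (0 : ℝ), ENNReal.ofReal (t ^ (-a - 1) * Real.exp (-(b / t))) =
      ENNReal.ofReal (b ^ (-a) * Real.Gamma a) := by
  have h := integral_rpow_mul_exp_neg_div ha hb
  rw [lintegral_ofReal_eq_ofReal_integral, h]
  · filter_upwards [ae_restrict_mem measurableSet_Ioi] with t (ht : 0 < t)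
    rw [Pi.zero_apply]
    positivity
  · rw [h]
    exact mul_pos (by positivity) (Real.Gamma_pos_of_pos ha)

theorem intervalIntegral_exp_neg_div {t : ℝ} (ht : t ≠ 0) (c : ℝ) :
    ∫ b in (0 : ℝ)..c, Real.exp (-(b / t)) = t * (1 - Real.exp (-(c / t))) := by
  have hderiv (b : ℝ) :
      HasDerivAt (fun b => -(t * Real.exp (-(b / t)))) (Real.exp (-(b / t))) b := by
    refine ((((hasDerivAt_id b).div_const t).neg.exp.const_mul t).neg).congr_deriv ?_
    field_simp
    simp
  rw [intervalIntegral.integral_eq_sub_of_hasDerivAt (fun b _ => hderiv b)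
    ((by fun_prop : Continuous _).intervalIntegrable 0 c)]
  simp
  ring

theorem ofReal_rpow_mul_one_sub_exp_eq_lintegral {t c : ℝ} (ht : 0 < t) (hc : 0 ≤ c) (s : ℝ) :
    ENNReal.ofReal (t ^ (s - 1) * (1 - Real.exp (-(c / t)))) =
      ∫⁻ b in Ioc 0 c, ENNReal.ofReal (t ^ (-(1 - s) - 1) * Real.exp (-(b / t))) := by
  have hcont : Continuous fun b : ℝ => t ^ (-(1 - s) - 1) * Real.exp (-(b / t)) := by fun_prop
  rw [← ofReal_integral_eq_lintegral_ofReal hcont.integrableOn_Ioc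
    (.of_forall fun b => by rw [Pi.zero_apply]; positivity),
    ← intervalIntegral.integral_of_le hc, intervalIntegral.integral_const_mul,
    intervalIntegral_exp_neg_div ht.ne', ← mul_assoc, ← Real.rpow_add_one ht.ne']
  ring_nf

theorem lintegral_rpow_mul_one_sub_exp {s c : ℝ} (hs : s ∈ Ioo (0 : ℝ) 1) (hc : 0 ≤ c) :
    ∫⁻ t in Ioi (0 : ℝ), ENNReal.ofReal (t ^ (s - 1) * (1 - Real.exp (-(c / t)))) =
      ENNReal.ofReal (c ^ s * (Real.Gamma (1 - s) / s)) := by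
  have hs' : 0 < 1 - s := sub_pos.2 hs.2
  have hint : IntervalIntegrable (fun b : ℝ => b ^ (-(1 - s))) volume 0 c :=
    intervalIntegral.intervalIntegrable_rpow' (by linarith [hs.1])
  rw [setLIntegral_congr_fun measurableSet_Ioi
      fun t ht => ofReal_rpow_mul_one_sub_exp_eq_lintegral ht hc s,
    lintegral_lintegral_swap (by fun_prop), setLIntegral_congr_fun measurableSet_Ioc
      fun b hb => lintegral_rpow_mul_exp_neg_div hs' hb.1,
    ← ofReal_integral_eq_lintegral_ofReal (hint.mul_const _).1,
    ← intervalIntegral.integral_of_le hc, intervalIntegral.integral_mul_const,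
    integral_rpow (.inl (by linarith [hs.1]))]
  · rw [neg_sub, sub_add_cancel, Real.zero_rpow hs.1.ne']
    ring_nf
  · filter_upwards [ae_restrict_mem measurableSet_Ioc] with b hb
    exact mul_nonneg (Real.rpow_nonneg hb.1.le _) (Real.Gamma_pos_of_pos hs').le

end GammaIntegrals

section NormalizationConstant

variable {V : Type*} [NormedAddCommGroup V] [InnerProductSpace ℝ V]

theorem cos_inner_mul_exp_eq_re (t : ℝ) (ξ v : V) :
    Real.cos ⟪ξ, v⟫ * Real.exp (-(t * ‖v‖ ^ 2)) =
      RCLike.re (Complex.exp (-(t : ℂ) * ‖v‖ ^ 2 + Complex.I * ⟪ξ, v⟫)) := by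
  rw [RCLike.re_eq_complex_re, Complex.exp_re, mul_comm]
  simp [← Complex.ofReal_pow]

theorem one_sub_cos_inner_div_norm_rpow_nonneg (p : ℝ) (ξ v : V) :
    0 ≤ (1 - Real.cos ⟪ξ, v⟫) / ‖v‖ ^ p :=
  div_nonneg (sub_nonneg.2 (Real.cos_le_one _)) (by positivity)

-- Subordination: `‖v‖ ^ (-2 * a)` is a superposition of Gaussians, whose integrals against
-- `cos ⟪ξ, v⟫` are explicit.
theorem ofReal_one_sub_cos_inner_div_norm_rpow_eq_lintegral {a : ℝ} (ha : 0 < a) (ξ v : V) :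
    ENNReal.ofReal ((1 - Real.cos ⟪ξ, v⟫) / ‖v‖ ^ (2 * a)) =
      ∫⁻ t in Ioi (0 : ℝ), ENNReal.ofReal (t ^ (a - 1) / Real.Gamma a *
        ((1 - Real.cos ⟪ξ, v⟫) * Real.exp (-(t * ‖v‖ ^ 2)))) := by
  rcases eq_or_ne v 0 with rfl | hv
  · simp
  have hΓ := Real.Gamma_pos_of_pos ha
  have hc : 0 ≤ (1 - Real.cos ⟪ξ, v⟫) / Real.Gamma a :=
    div_nonneg (sub_nonneg.2 (Real.cos_le_one _)) hΓ.le
  have hrw (t : ℝ) : t ^ (a - 1) / Real.Gamma a *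
        ((1 - Real.cos ⟪ξ, v⟫) * Real.exp (-(t * ‖v‖ ^ 2))) =
      (1 - Real.cos ⟪ξ, v⟫) / Real.Gamma a * (t ^ (a - 1) * Real.exp (-(‖v‖ ^ 2 * t))) := by
    ring_nf
  simp_rw [hrw, ENNReal.ofReal_mul hc]
  rw [lintegral_const_mul _ (by fun_prop), lintegral_rpow_mul_exp_neg_mul ha (by positivity),
    ← ENNReal.ofReal_mul hc, one_div, Real.inv_rpow (by positivity), ← Real.rpow_natCast_mul
    (norm_nonneg v), Nat.cast_ofNat]
  field_simp

variable [FiniteDimensional ℝ V] [MeasurableSpace V] [BorelSpace V]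

theorem integrable_cos_inner_mul_exp {t : ℝ} (ht : 0 < t) (ξ : V) :
    Integrable fun v : V => Real.cos ⟪ξ, v⟫ * Real.exp (-(t * ‖v‖ ^ 2)) := by
  simp_rw [cos_inner_mul_exp_eq_re]
  exact (GaussianFourier.integrable_cexp_neg_mul_sq_norm_add (by simpa using ht) _ ξ).re

theorem integral_cos_inner_mul_exp {t : ℝ} (ht : 0 < t) (ξ : V) :
    ∫ v : V, Real.cos ⟪ξ, v⟫ * Real.exp (-(t * ‖v‖ ^ 2)) =
      (Real.pi / t) ^ ((finrank ℝ V : ℝ) / 2) * Real.exp (-(‖ξ‖ ^ 2 / 4 / t)) := by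
  have htc : 0 < (t : ℂ).re := by simpa using ht
  simp_rw [cos_inner_mul_exp_eq_re]
  rw [integral_re (GaussianFourier.integrable_cexp_neg_mul_sq_norm_add htc _ ξ),
    GaussianFourier.integral_cexp_neg_mul_sq_norm_add htc, RCLike.re_eq_complex_re,
    show (Complex.I ^ 2 * (‖ξ‖ : ℂ) ^ 2 / (4 * t)) = ((-(‖ξ‖ ^ 2 / 4 / t) : ℝ) : ℂ) by
      push_cast
      rw [Complex.I_sq]
      field_simp,
    show (Real.pi / t : ℂ) ^ (finrank ℝ V / 2 : ℂ) =
        (((Real.pi / t) ^ ((finrank ℝ V : ℝ) / 2) : ℝ) : ℂ) by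
      rw [Complex.ofReal_cpow (by positivity)]
      push_cast
      rfl,
    ← Complex.ofReal_exp, ← Complex.ofReal_mul, Complex.ofReal_re]

theorem integrable_one_sub_cos_inner_mul_exp {t : ℝ} (ht : 0 < t) (ξ : V) :
    Integrable fun v : V => (1 - Real.cos ⟪ξ, v⟫) * Real.exp (-(t * ‖v‖ ^ 2)) := by
  simpa only [sub_mul, Pi.sub_def, inner_zero_left, Real.cos_zero] using
    (integrable_cos_inner_mul_exp ht (0 : V)).sub (integrable_cos_inner_mul_exp ht ξ)

theorem integral_one_sub_cos_inner_mul_exp {t : ℝ} (ht : 0 < t) (ξ : V) :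
    ∫ v : V, (1 - Real.cos ⟪ξ, v⟫) * Real.exp (-(t * ‖v‖ ^ 2)) =
      (Real.pi / t) ^ ((finrank ℝ V : ℝ) / 2) * (1 - Real.exp (-(‖ξ‖ ^ 2 / 4 / t))) := by
  have h := integral_sub (integrable_cos_inner_mul_exp ht (0 : V))
    (integrable_cos_inner_mul_exp ht ξ)
  rw [integral_cos_inner_mul_exp ht, integral_cos_inner_mul_exp ht] at h
  simpa [sub_mul, mul_sub] using h

theorem lintegral_ofReal_one_sub_cos_inner_mul_exp {a t : ℝ} (ha : 0 < a) (ht : 0 < t) (ξ : V) :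
    ∫⁻ v : V, ENNReal.ofReal (t ^ (a - 1) / Real.Gamma a *
        ((1 - Real.cos ⟪ξ, v⟫) * Real.exp (-(t * ‖v‖ ^ 2)))) =
      ENNReal.ofReal (Real.pi ^ ((finrank ℝ V : ℝ) / 2) / Real.Gamma a) *
        ENNReal.ofReal (t ^ (a - finrank ℝ V / 2 - 1) * (1 - Real.exp (-(‖ξ‖ ^ 2 / 4 / t)))) := by
  rw [← ofReal_integral_eq_lintegral_ofReal
      ((integrable_one_sub_cos_inner_mul_exp ht ξ).const_mul _)
      (.of_forall fun v => mul_nonneg (by positivity)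
        (mul_nonneg (sub_nonneg.2 (Real.cos_le_one _)) (Real.exp_nonneg _))),
    integral_const_mul, integral_one_sub_cos_inner_mul_exp ht,
    ← ENNReal.ofReal_mul (by positivity), Real.div_rpow Real.pi_pos.le ht.le,
    sub_right_comm, Real.rpow_sub ht (a - 1)]
  ring_nf

theorem fracLaplacianConst_pos (n : ℕ) {s : ℝ} (hs : s ∈ Ioo (0 : ℝ) 1) :
    0 < fracLaplacianConst n s := by
  have hs0 := hs.1
  have hs1 : 0 < 1 - s := sub_pos.2 hs.2
  unfold fracLaplacianConst
  exact div_pos (by positivity) (mul_pos (by positivity) (Real.Gamma_pos_of_pos hs1))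

theorem lintegral_one_sub_cos_inner_div_norm_rpow {s : ℝ} (hs : s ∈ Ioo (0 : ℝ) 1) (ξ : V) :
    ∫⁻ v : V, ENNReal.ofReal ((1 - Real.cos ⟪ξ, v⟫) / ‖v‖ ^ (finrank ℝ V + 2 * s)) =
      ENNReal.ofReal (‖ξ‖ ^ (2 * s) / fracLaplacianConst (finrank ℝ V) s) := by
  have hs0 := hs.1
  have ha : 0 < (finrank ℝ V : ℝ) / 2 + s := by positivity
  have hΓ := (Real.Gamma_pos_of_pos (sub_pos.2 hs.2)).ne'
  rw [show finrank ℝ V + 2 * s = 2 * ((finrank ℝ V : ℝ) / 2 + s) by ring]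
  simp_rw [ofReal_one_sub_cos_inner_div_norm_rpow_eq_lintegral ha]
  rw [lintegral_lintegral_swap (by fun_prop), setLIntegral_congr_fun measurableSet_Ioi
      fun t ht => lintegral_ofReal_one_sub_cos_inner_mul_exp ha ht ξ,
    lintegral_const_mul _ (by fun_prop), add_sub_cancel_left,
    lintegral_rpow_mul_one_sub_exp hs (by positivity), ← ENNReal.ofReal_mul (by positivity),
    Real.div_rpow (by positivity) (by norm_num), ← Real.rpow_natCast_mul (norm_nonneg ξ)]
  unfold fracLaplacianConst
  push_cast
  field_simp [hΓ]

theorem integrable_one_sub_cos_inner_div_norm_rpow {s : ℝ} (hs : s ∈ Ioo (0 : ℝ) 1) (ξ : V) :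
    Integrable fun v : V => (1 - Real.cos ⟪ξ, v⟫) / ‖v‖ ^ (finrank ℝ V + 2 * s) := by
  refine ⟨(by fun_prop : Measurable _).aestronglyMeasurable, ?_⟩
  rw [hasFiniteIntegral_iff_ofReal
      (.of_forall fun v => one_sub_cos_inner_div_norm_rpow_nonneg _ ξ v),
    lintegral_one_sub_cos_inner_div_norm_rpow hs]
  exact ENNReal.ofReal_lt_top

theorem integral_one_sub_cos_inner_div_norm_rpow {s : ℝ} (hs : s ∈ Ioo (0 : ℝ) 1) (ξ : V) :
    ∫ v : V, (1 - Real.cos ⟪ξ, v⟫) / ‖v‖ ^ (finrank ℝ V + 2 * s) =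
      ‖ξ‖ ^ (2 * s) / fracLaplacianConst (finrank ℝ V) s := by
  rw [integral_eq_lintegral_of_nonneg_ae
      (.of_forall fun v => one_sub_cos_inner_div_norm_rpow_nonneg _ ξ v)
      (by fun_prop : Measurable _).aestronglyMeasurable,
    lintegral_one_sub_cos_inner_div_norm_rpow hs, ENNReal.toReal_ofReal]
  exact div_nonneg (by positivity) (fracLaplacianConst_pos _ hs).le

end NormalizationConstant

section Definitions

variable {V F : Type*} [NormedAddCommGroup V]

/-- The difference quotient `(g z - g (z + v)) / |v|ᵖ` of `g` at `z`, as a function of the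
displacement `v`; it takes the value `0` at `v = 0`. -/
noncomputable def diffQuotient [AddCommGroup F] [Module ℝ F] (p : ℝ) (g : V → F) (z v : V) : F :=
  (‖v‖ ^ p)⁻¹ • (g z - g (z + v))

/-- The symmetric second difference quotient `(2 g z - g (z + v) - g (z - v)) / |v|ᵖ`. The
first-order term of `g` at `z` cancels in it, so it is integrable near `v = 0` when `diffQuotient`
may fail to be. -/
noncomputable def symmDiffQuotient [AddCommGroup F] [Module ℝ F] (p : ℝ) (g : V → F) (z v : V) :
    F :=
  diffQuotient p g z v + diffQuotient p g z (-v)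

/-- The classical fractional Laplacian `(-Δ)ˢ g`, as the Fourier multiplier `|ξ|²ˢ`. Since `𝓕` has
the kernel `exp (-2πi⟨η, v⟩)`, the frequency `ξ` is `2πη`. -/
noncomputable def fracLaplacian [InnerProductSpace ℝ V] [FiniteDimensional ℝ V] [MeasurableSpace V]
    [BorelSpace V] [NormedAddCommGroup F] [NormedSpace ℂ F] (s : ℝ) (g : V → F) : V → F :=
  𝓕⁻ fun η => ‖(2 * Real.pi) • η‖ ^ (2 * s) • 𝓕 g η

end Definitions

section FourierSide

variable {V F : Type*} [NormedAddCommGroup V] [InnerProductSpace ℝ V] [FiniteDimensional ℝ V]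
  [MeasurableSpace V] [BorelSpace V] [NormedAddCommGroup F]

theorem integrable_prod_one_sub_cos_inner_div_smul [NormedSpace ℝ F] {s : ℝ}
    (hs : s ∈ Ioo (0 : ℝ) 1) {h : V → F} (hmeas : AEStronglyMeasurable h)
    (hh : Integrable fun η => ‖(2 * Real.pi) • η‖ ^ (2 * s) • h η) :
    Integrable (fun q : V × V => ((1 - Real.cos ⟪(2 * Real.pi) • q.2, q.1⟫) /
      ‖q.1‖ ^ (finrank ℝ V + 2 * s)) • h q.2) (volume.prod volume) := by
  have hker : Measurable fun q : V × V =>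
      (1 - Real.cos ⟪(2 * Real.pi) • q.2, q.1⟫) / ‖q.1‖ ^ (finrank ℝ V + 2 * s) := by fun_prop
  have hmeas' := hker.aestronglyMeasurable.smul (hmeas.comp_snd (μ := volume (α := V)))
  have hslice (η : V) : Integrable fun v : V => ((1 - Real.cos ⟪(2 * Real.pi) • η, v⟫) /
      ‖v‖ ^ (finrank ℝ V + 2 * s)) • h η :=
    (integrable_one_sub_cos_inner_div_norm_rpow hs _).smul_const _
  refine (integrable_prod_iff' hmeas').2 ⟨.of_forall hslice, ?_⟩
  refine (hh.norm.div_const (fracLaplacianConst (finrank ℝ V) s)).congr (.of_forall fun η => ?_)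
  simp only [Pi.smul_apply', norm_smul (_ / _ : ℝ),
    Real.norm_of_nonneg (one_sub_cos_inner_div_norm_rpow_nonneg _ _ _)]
  rw [integral_mul_const, integral_one_sub_cos_inner_div_norm_rpow hs, norm_smul,
    Real.norm_of_nonneg (by positivity)]
  ring

variable [NormedSpace ℂ F]

theorem fourierChar_smul_sub_add_sub (a b : ℝ) (x : F) :
    (Real.fourierChar a • x - Real.fourierChar (a + b) • x) +
        (Real.fourierChar a • x - Real.fourierChar (a + -b) • x) =
      (1 - Real.cos (2 * Real.pi * b)) • (2 : ℝ) • Real.fourierChar a • x := by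
  have hcos : (Real.fourierChar b : ℂ) + (Real.fourierChar (-b) : ℂ) =
      2 * (Real.cos (2 * Real.pi * b) : ℂ) := by
    rw [Real.fourierChar_apply, Real.fourierChar_apply, Complex.ofReal_cos, Complex.two_cos]
    push_cast
    ring_nf
  simp only [Circle.smul_def, AddChar.map_add_eq_mul, Circle.coe_mul,
    ← Complex.coe_smul, smul_smul, ← sub_smul, ← add_smul]
  congr 1
  push_cast at hcos ⊢
  linear_combination -(Real.fourierChar a : ℂ) * hcos

theorem symmDiffQuotient_fourierInv {h : V → F} (hh : Integrable h) (p : ℝ) (z v : V) :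
    symmDiffQuotient p (𝓕⁻ h) z v = ∫ η, ((1 - Real.cos ⟪(2 * Real.pi) • η, v⟫) / ‖v‖ ^ p) •
      (2 : ℝ) • Real.fourierChar ⟪η, z⟫ • h η := by
  have hint (y : V) : Integrable fun η => Real.fourierChar ⟪η, y⟫ • h η := by
    simpa using (Real.fourierIntegral_convergent_iff (-y)).2 hh
  have hdiff (y : V) : Integrable fun η =>
      Real.fourierChar ⟪η, z⟫ • h η - Real.fourierChar ⟪η, y⟫ • h η := (hint z).sub (hint y)
  simp only [symmDiffQuotient, diffQuotient, norm_neg, ← smul_add, Real.fourierInv_eq]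
  rw [← integral_sub (hint _) (hint _), ← integral_sub (hint _) (hint _),
    ← integral_add (hdiff _) (hdiff _), ← integral_smul]
  refine integral_congr_ae (.of_forall fun η => ?_)
  simp only [inner_add_right, inner_neg_right, fourierChar_smul_sub_add_sub,
    real_inner_smul_left, smul_smul]
  ring_nf

theorem integrable_prod_one_sub_cos_inner_div_smul_fourierChar {s : ℝ} (hs : s ∈ Ioo (0 : ℝ) 1)
    {h : V → F} (hh : Integrable h)
    (hh' : Integrable fun η => ‖(2 * Real.pi) • η‖ ^ (2 * s) • h η) (z : V) :
    Integrable (fun q : V × V => ((1 - Real.cos ⟪(2 * Real.pi) • q.2, q.1⟫) /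
      ‖q.1‖ ^ (finrank ℝ V + 2 * s)) • (2 : ℝ) • Real.fourierChar ⟪q.2, z⟫ • h q.2)
      (volume.prod volume) := by
  have hint {k : V → F} (hk : Integrable k) :
      Integrable fun η => (2 : ℝ) • Real.fourierChar ⟪η, z⟫ • k η := by
    simpa [Pi.smul_def] using ((Real.fourierIntegral_convergent_iff (-z)).2 hk).smul (2 : ℝ)
  refine integrable_prod_one_sub_cos_inner_div_smul hs (hint hh).aestronglyMeasurable ?_
  refine (hint hh').congr (.of_forall fun η => ?_)
  simp only [Circle.smul_def, ← Complex.coe_smul, smul_smul]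
  ring_nf

theorem integrable_symmDiffQuotient_fourierInv {s : ℝ} (hs : s ∈ Ioo (0 : ℝ) 1) {h : V → F}
    (hh : Integrable h) (hh' : Integrable fun η => ‖(2 * Real.pi) • η‖ ^ (2 * s) • h η) (z : V) :
    Integrable (symmDiffQuotient (finrank ℝ V + 2 * s) (𝓕⁻ h) z) := by
  simp only [funext (symmDiffQuotient_fourierInv hh _ z)]
  exact (integrable_prod_one_sub_cos_inner_div_smul_fourierChar hs hh hh' z).integral_prod_left

variable [CompleteSpace F]

theorem integral_symmDiffQuotient_fourierInv {s : ℝ} (hs : s ∈ Ioo (0 : ℝ) 1) {h : V → F}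
    (hh : Integrable h) (hh' : Integrable fun η => ‖(2 * Real.pi) • η‖ ^ (2 * s) • h η) (z : V) :
    ∫ v, symmDiffQuotient (finrank ℝ V + 2 * s) (𝓕⁻ h) z v =
      (2 / fracLaplacianConst (finrank ℝ V) s) •
        𝓕⁻ (fun η => ‖(2 * Real.pi) • η‖ ^ (2 * s) • h η) z := by
  simp only [symmDiffQuotient_fourierInv hh]
  rw [integral_integral_swap
    (integrable_prod_one_sub_cos_inner_div_smul_fourierChar hs hh hh' z), Real.fourierInv_eq,
    ← integral_smul]
  refine integral_congr_ae (.of_forall fun η => ?_)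
  simp only [integral_smul_const, integral_one_sub_cos_inner_div_norm_rpow hs]
  simp only [Circle.smul_def, ← Complex.coe_smul, smul_smul]
  push_cast
  ring_nf

variable {g : V → F}

theorem integrable_symmDiffQuotient {s : ℝ} (hs : s ∈ Ioo (0 : ℝ) 1) (hcont : Continuous g)
    (hint : Integrable g) (hint' : Integrable (𝓕 g))
    (hsymb : Integrable fun η => ‖(2 * Real.pi) • η‖ ^ (2 * s) • 𝓕 g η) (z : V) :
    Integrable (symmDiffQuotient (finrank ℝ V + 2 * s) g z) := by
  simpa only [hcont.fourierInv_fourier_eq hint hint'] using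
    integrable_symmDiffQuotient_fourierInv hs hint' hsymb z

theorem fracLaplacian_eq_integral_symmDiffQuotient {s : ℝ} (hs : s ∈ Ioo (0 : ℝ) 1)
    (hcont : Continuous g) (hint : Integrable g) (hint' : Integrable (𝓕 g))
    (hsymb : Integrable fun η => ‖(2 * Real.pi) • η‖ ^ (2 * s) • 𝓕 g η) (z : V) :
    fracLaplacian s g z = fracLaplacianConst (finrank ℝ V) s •
      (1 / 2 : ℝ) • ∫ v, symmDiffQuotient (finrank ℝ V + 2 * s) g z v := by
  have hC := (fracLaplacianConst_pos (finrank ℝ V) hs).ne'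
  have h := integral_symmDiffQuotient_fourierInv hs hint' hsymb z
  rw [hcont.fourierInv_fourier_eq hint hint'] at h
  rw [h, smul_smul, smul_smul, fracLaplacian]
  field_simp
  simp

end FourierSide

section SetIntegral

variable {α F : Type*} [MeasurableSpace α] {μ : Measure α} [NormedAddCommGroup F] [NormedSpace ℝ F]
  {f : α → F}

theorem norm_setIntegral_sub_setIntegral_le {S T : Set α} {C : ℝ} (hS : MeasurableSet S)
    (hT : MeasurableSet T) (hfS : IntegrableOn f S μ) (hfT : IntegrableOn f T μ)
    (hμ : μ (S ∆ T) < ⊤) (hC : ∀ a ∈ S ∆ T, ‖f a‖ ≤ C) :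
    ‖∫ a in S, f a ∂μ - ∫ a in T, f a ∂μ‖ ≤ C * μ.real (S ∆ T) := by
  have hST : μ (S \ T) < ⊤ := (measure_mono subset_union_left).trans_lt hμ
  have hTS : μ (T \ S) < ⊤ := (measure_mono subset_union_right).trans_lt hμ
  calc ‖∫ a in S, f a ∂μ - ∫ a in T, f a ∂μ‖
      = ‖∫ a in S \ T, f a ∂μ - ∫ a in T \ S, f a ∂μ‖ := by
        rw [← integral_inter_add_sdiff hT hfS, ← integral_inter_add_sdiff hS hfT, inter_comm T S,
          add_sub_add_left_eq_sub]
    _ ≤ C * μ.real (S \ T) + C * μ.real (T \ S) :=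
        (norm_sub_le _ _).trans (add_le_add
          (norm_setIntegral_le_of_norm_le_const hST fun a ha => hC a (.inl ha))
          (norm_setIntegral_le_of_norm_le_const hTS fun a ha => hC a (.inr ha)))
    _ = C * μ.real (S ∆ T) := by
        rw [← mul_add, Set.symmDiff_def, measureReal_union disjoint_sdiff_sdiff
          (hT.diff hS) hST.ne hTS.ne]

theorem tendsto_setIntegral_setOf_lt {ρ : α → ℝ} (hρ : Measurable ρ) (hf : Integrable f μ)
    (hpos : ∀ a, f a ≠ 0 → 0 < ρ a) :
    Tendsto (fun ε => ∫ a in {a | ε < ρ a}, f a ∂μ) (𝓝[>] 0) (𝓝 (∫ a, f a ∂μ)) := by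
  have hmeas (ε : ℝ) : MeasurableSet {a | ε < ρ a} := measurableSet_lt measurable_const hρ
  simp_rw [← integral_indicator (hmeas _)]
  refine tendsto_integral_filter_of_dominated_convergence (fun a => ‖f a‖)
    (.of_forall fun ε => hf.aestronglyMeasurable.indicator (hmeas ε))
    (.of_forall fun ε => .of_forall fun a => norm_indicator_le_norm_self _ _) hf.norm
    (.of_forall fun a => ?_)
  refine tendsto_const_nhds.congr' ?_
  by_cases ha : f a = 0
  · simp [indicator, ha]
  · filter_upwards [Ioo_mem_nhdsGT (hpos a ha)] with ε hε
    rw [indicator_of_mem (by exact hε.2)]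

end SetIntegral

section Shell

variable {V : Type*} [NormedAddCommGroup V] [NormedSpace ℝ V]

/-- The shell around the ellipsoid `‖A v‖ = ε` of thickness comparable to `ε²`. -/
def ellipsoidalShell (A : V ≃L[ℝ] V) (D ε : ℝ) : Set V :=
  {v | |‖A v‖ - ε| ≤ D * ε ^ 2}

variable (A : V ≃L[ℝ] V)

theorem exists_norm_equiv_bounds :
    ∃ c > 0, ∃ C > 0, ∀ v, c * ‖A v‖ ≤ ‖v‖ ∧ ‖v‖ ≤ C * ‖A v‖ := by
  obtain ⟨K, hK, hAK⟩ := (A : V →L[ℝ] V).bound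
  obtain ⟨C, hC, hAC⟩ := (A.symm : V →L[ℝ] V).bound
  refine ⟨K⁻¹, inv_pos.2 hK, C, hC, fun v => ⟨?_, by simpa using hAC (A v)⟩⟩
  rw [inv_mul_le_iff₀ hK]
  exact hAK v

theorem eventually_norm_mem_Icc_of_mem_ellipsoidalShell (D : ℝ) :
    ∃ c > 0, ∃ C > 0, ∀ᶠ ε in 𝓝[>] 0, ∀ v ∈ ellipsoidalShell A D ε,
      ‖v‖ ∈ Icc (c * ε) (C * ε) := by
  obtain ⟨c, hc, C, hC, hbound⟩ := exists_norm_equiv_bounds A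
  have hD : Tendsto (fun ε : ℝ => D * ε) (𝓝[>] 0) (𝓝 0) :=
    tendsto_nhdsWithin_of_tendsto_nhds (by simpa using (continuous_const_mul D).tendsto 0)
  refine ⟨c / 2, by positivity, C * 2, by positivity, ?_⟩
  filter_upwards [self_mem_nhdsWithin, hD.eventually_le_const one_half_pos]
    with ε (hε : 0 < ε) hDε v hv
  have hshell : |‖A v‖ - ε| ≤ ε / 2 := hv.trans (by nlinarith)
  rw [abs_le] at hshell
  obtain ⟨hlow, hup⟩ := hbound v
  constructor <;> nlinarith

theorem ellipsoidalShell_subset_preimage (D ε : ℝ) :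
    ellipsoidalShell A D ε ⊆
      A ⁻¹' (closedBall 0 (ε * (1 + D * ε)) \ ball 0 (ε * (1 - D * ε))) := by
  intro v (hv : |‖A v‖ - ε| ≤ D * ε ^ 2)
  rw [abs_le] at hv
  rw [mem_preimage, Set.mem_sdiff, mem_closedBall_zero_iff, mem_ball_zero_iff, not_lt]
  constructor <;> linarith

theorem isBounded_ellipsoidalShell (D ε : ℝ) : Bornology.IsBounded (ellipsoidalShell A D ε) :=
  (A.antilipschitz.isBounded_preimage isBounded_closedBall).subset
    ((ellipsoidalShell_subset_preimage A D ε).trans (preimage_mono sdiff_subset))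

variable [FiniteDimensional ℝ V] [MeasurableSpace V] [BorelSpace V] (μ : Measure V)
  [μ.IsAddHaarMeasure]

theorem measureReal_closedBall_sdiff_ball {r R : ℝ} (hr : 0 < r) (hrR : r ≤ R) :
    μ.real (closedBall 0 R \ ball 0 r) =
      (R ^ finrank ℝ V - r ^ finrank ℝ V) * μ.real (ball 0 1) := by
  have hball : μ.real (ball (0 : V) r) = r ^ finrank ℝ V * μ.real (ball 0 1) := by
    rw [measureReal_def, Measure.addHaar_ball_of_pos μ 0 hr, ENNReal.toReal_mul,
      ENNReal.toReal_ofReal (by positivity), measureReal_def]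
  rw [measureReal_sdiff (ball_subset_closedBall.trans (closedBall_subset_closedBall hrR))
      measurableSet_ball measure_closedBall_lt_top.ne,
    Measure.addHaar_real_closedBall _ _ (hr.le.trans hrR), hball, sub_mul]

theorem measureReal_ellipsoidalShell_le {D ε : ℝ} (hD : 0 ≤ D) (hε : 0 < ε) (hDε : D * ε < 1) :
    μ.real (ellipsoidalShell A D ε) ≤
      |LinearMap.det (A.symm : V →ₗ[ℝ] V)| * μ.real (ball 0 1) *
        (((1 + D * ε) ^ finrank ℝ V - (1 - D * ε) ^ finrank ℝ V) * ε ^ finrank ℝ V) := by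
  have hDε' : 0 ≤ D * ε := by positivity
  have hvol := measureReal_closedBall_sdiff_ball μ (mul_pos hε (sub_pos.2 hDε))
    (show ε * (1 - D * ε) ≤ ε * (1 + D * ε) by gcongr; linarith)
  have hpre (S : Set V) :
      μ.real (A ⁻¹' S) = |LinearMap.det (A.symm : V →ₗ[ℝ] V)| * μ.real S := by
    rw [measureReal_def, Measure.addHaar_preimage_continuousLinearEquiv, ENNReal.toReal_mul,
      ENNReal.toReal_ofReal (abs_nonneg _), measureReal_def]
  have hfin : μ (A ⁻¹' (closedBall 0 (ε * (1 + D * ε)) \ ball 0 (ε * (1 - D * ε)))) ≠ ⊤ := by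
    rw [Measure.addHaar_preimage_continuousLinearEquiv]
    exact ENNReal.mul_ne_top ENNReal.ofReal_ne_top
      (measure_ne_top_of_subset sdiff_subset measure_closedBall_lt_top.ne)
  refine (measureReal_mono (ellipsoidalShell_subset_preimage A D ε) hfin).trans_eq ?_
  rw [hpre, hvol, mul_pow, mul_pow]
  ring

theorem measureReal_ellipsoidalShell_isBigO {D : ℝ} (hD : 0 ≤ D) :
    (fun ε => μ.real (ellipsoidalShell A D ε)) =O[𝓝[>] 0] fun ε => ε ^ (finrank ℝ V + 1) := by
  -- The two powers agree at `ε = 0`, which gains the extra factor `ε` over the volume of a ball.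
  have hdiff : DifferentiableAt ℝ
      (fun ε : ℝ => (1 + D * ε) ^ finrank ℝ V - (1 - D * ε) ^ finrank ℝ V) 0 := by fun_prop
  have hlin := hdiff.isBigO_sub.mono (nhdsWithin_le_nhds (s := Ioi 0))
  simp only [mul_zero, add_zero, sub_zero, sub_self] at hlin
  refine .trans ?_ (((hlin.mul (isBigO_refl (fun ε : ℝ => ε ^ finrank ℝ V) _)).const_mul_left
    (|LinearMap.det (A.symm : V →ₗ[ℝ] V)| * μ.real (ball 0 1))).congr_right
    fun ε => (pow_succ' ε _).symm)
  have hDε : Tendsto (fun ε : ℝ => D * ε) (𝓝[>] 0) (𝓝 0) :=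
    tendsto_nhdsWithin_of_tendsto_nhds (by simpa using (continuous_const_mul D).tendsto 0)
  refine .of_bound' ?_
  filter_upwards [self_mem_nhdsWithin, hDε.eventually_lt_const one_pos] with ε hε hDε
  rw [Real.norm_of_nonneg measureReal_nonneg]
  exact (measureReal_ellipsoidalShell_le A μ hD hε hDε).trans (Real.le_norm_self _)

end Shell

section Gauge

variable {V : Type*} [NormedAddCommGroup V] [NormedSpace ℝ V]

/-- A function `ρ` on displacements whose regions `{ρ > ε}` may be used to excise the origin: it
agrees with `‖A v‖` to second order at `0`, and it is small only near `0`. -/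
structure IsExcisionGauge [MeasurableSpace V] (ρ : V → ℝ) (A : V ≃L[ℝ] V) : Prop where
  measurable : Measurable ρ
  isBigO : (fun v => ρ v - ‖A v‖) =O[𝓝 0] fun v => ‖v‖ ^ 2
  exists_le : ∀ r > 0, ∃ δ > 0, ∀ v, r ≤ ‖v‖ → δ ≤ ρ v

namespace IsExcisionGauge

variable [MeasurableSpace V] {ρ : V → ℝ} {A : V ≃L[ℝ] V}

theorem norm_apply [BorelSpace V] (A : V ≃L[ℝ] V) : IsExcisionGauge (fun v => ‖A v‖) A where
  measurable := A.continuous.norm.measurable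
  isBigO := by simpa using isBigO_zero _ _
  exists_le r hr := by
    obtain ⟨_, _, C, hC, hbound⟩ := exists_norm_equiv_bounds A
    exact ⟨r / C, by positivity, fun v hv => (div_le_iff₀' hC).2 (hv.trans (hbound v).2)⟩

theorem exists_setOf_lt_subset (hρ : IsExcisionGauge ρ A) {ε : ℝ} (hε : 0 < ε) :
    ∃ r > 0, {v | ε < ρ v} ⊆ {v | r ≤ ‖v‖} := by
  have hsq : Tendsto (fun v : V => ‖v‖ ^ 2) (𝓝 0) (𝓝 0) := by
    simpa using (by fun_prop : Continuous fun v : V => ‖v‖ ^ 2).tendsto 0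
  have hA : Tendsto (fun v => ‖A v‖) (𝓝 0) (𝓝 0) := by
    simpa using (A.continuous.norm).tendsto (0 : V)
  have hlim : Tendsto ρ (𝓝 0) (𝓝 0) := by
    simpa using (hρ.isBigO.trans_tendsto hsq).add hA
  obtain ⟨r, hr, hsub⟩ := Metric.eventually_nhds_iff.1 (hlim.eventually_lt_const hε)
  refine ⟨r, hr, fun v hv => ?_⟩
  contrapose! hv
  simpa using (hsub (by simpa using hv)).le

theorem exists_abs_sub_le_and_norm_le (hρ : IsExcisionGauge ρ A) :
    ∃ M ≥ 0, ∃ r > 0, ∀ v, ‖v‖ < r → |ρ v - ‖A v‖| ≤ M * ‖v‖ ^ 2 ∧ ‖A v‖ ≤ 2 * ρ v := by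
  obtain ⟨_, _, C, hC, hbound⟩ := exists_norm_equiv_bounds A
  obtain ⟨M, hM, hMρ⟩ := hρ.isBigO.exists_pos
  obtain ⟨r, hr, hclose⟩ := Metric.eventually_nhds_iff.1 hMρ.bound
  refine ⟨M, hM.le, min r (1 / (2 * M * C)), by positivity, fun v hv => ?_⟩
  obtain ⟨hvr, hvM⟩ := lt_min_iff.1 hv
  have hdist : |ρ v - ‖A v‖| ≤ M * ‖v‖ ^ 2 := by
    simpa using hclose (show dist v 0 < r by simpa using hvr)
  have hhalf : M * ‖v‖ ^ 2 ≤ ‖A v‖ / 2 :=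
    calc M * ‖v‖ ^ 2 = M * ‖v‖ * ‖v‖ := by ring
      _ ≤ M * (1 / (2 * M * C)) * (C * ‖A v‖) := by
        gcongr
        exact (hbound v).2
      _ = ‖A v‖ / 2 := by field_simp
  exact ⟨hdist, by linarith [(abs_le.1 hdist).1]⟩

theorem exists_symmDiff_subset_ellipsoidalShell (hρ : IsExcisionGauge ρ A) :
    ∃ D ≥ 0, ∀ᶠ ε in 𝓝[>] 0, {v | ε < ρ v} ∆ {v | ε < ‖A v‖} ⊆ ellipsoidalShell A D ε := by
  obtain ⟨_, _, C, hC, hbound⟩ := exists_norm_equiv_bounds A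
  obtain ⟨M, hM, r, hr, hclose⟩ := hρ.exists_abs_sub_le_and_norm_le
  obtain ⟨δ, hδ, hδρ⟩ := hρ.exists_le r hr
  refine ⟨M * (C * 2) ^ 2, by positivity, ?_⟩
  filter_upwards [Ioo_mem_nhdsGT (lt_min hδ (div_pos hr hC))] with ε ⟨hε, hεlt⟩ v hv
  obtain ⟨hεδ, hεr⟩ := lt_min_iff.1 hεlt
  rw [Set.mem_symmDiff, mem_ofPred, mem_ofPred, not_lt, not_lt] at hv
  have hvr : ‖v‖ < r := by
    rcases hv with ⟨-, hAε⟩ | ⟨-, hρε⟩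
    · rw [lt_div_iff₀ hC, mul_comm] at hεr
      exact ((hbound v).2.trans (by gcongr)).trans_lt hεr
    · exact lt_of_not_ge fun hrv => ((hδρ v hrv).trans hρε).not_gt hεδ
  obtain ⟨hdist, hAρ⟩ := hclose v hvr
  have hA2 : ‖A v‖ ≤ 2 * ε := by rcases hv with ⟨-, h⟩ | ⟨-, h⟩ <;> linarith
  have hvε : ‖v‖ ≤ C * 2 * ε := by
    rw [mul_assoc]
    exact (hbound v).2.trans (by gcongr)
  calc |‖A v‖ - ε| ≤ |ρ v - ‖A v‖| := by
        rcases hv with ⟨h₁, h₂⟩ | ⟨h₁, h₂⟩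
        · rw [abs_of_nonpos (by linarith), abs_of_nonneg (by linarith)]
          linarith
        · rw [abs_of_nonneg (by linarith), abs_of_nonpos (by linarith)]
          linarith
    _ ≤ M * (C * 2 * ε) ^ 2 := hdist.trans (by gcongr)
    _ = M * (C * 2) ^ 2 * ε ^ 2 := by ring

end IsExcisionGauge

end Gauge

section PrincipalValue

variable {V F : Type*} [NormedAddCommGroup V] [NormedSpace ℝ V] [NormedAddCommGroup F]
  [NormedSpace ℝ F] {g : V → F} {p : ℝ}

theorem exists_norm_diffQuotient_le_of_mem_ellipsoidalShell {z : V} (hg : DifferentiableAt ℝ g z)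
    (hp : 0 ≤ p) (A : V ≃L[ℝ] V) (D : ℝ) :
    ∃ M ≥ 0, ∀ᶠ ε in 𝓝[>] 0, ∀ v ∈ ellipsoidalShell A D ε,
      ‖diffQuotient p g z v‖ ≤ M * (ε / ε ^ p) := by
  obtain ⟨c, hc, C, hC, hshell⟩ := eventually_norm_mem_Icc_of_mem_ellipsoidalShell A D
  obtain ⟨B, hB, hgB⟩ := hg.isBigO_sub.exists_pos
  obtain ⟨r, hr, hclose⟩ := Metric.eventually_nhds_iff.1 hgB.bound
  refine ⟨(c ^ p)⁻¹ * (B * C), by positivity, ?_⟩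
  filter_upwards [hshell, Ioo_mem_nhdsGT (show 0 < r / C by positivity)] with ε hmem hε v hv
  obtain ⟨hcε, hCε⟩ := hmem v hv
  have hε0 : 0 < ε := hε.1
  have hvr : ‖v‖ < r := hCε.trans_lt (by rw [mul_comm]; exact (lt_div_iff₀ hC).1 hε.2)
  have hgv : ‖g (z + v) - g z‖ ≤ B * ‖v‖ := by
    simpa using hclose (y := z + v) (by simpa using hvr)
  calc ‖diffQuotient p g z v‖ = (‖v‖ ^ p)⁻¹ * ‖g (z + v) - g z‖ := by
        rw [diffQuotient, norm_smul, Real.norm_of_nonneg (by positivity), norm_sub_rev]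
    _ ≤ ((c * ε) ^ p)⁻¹ * (B * (C * ε)) := by
        gcongr
        exact hgv.trans (by gcongr)
    _ = (c ^ p)⁻¹ * (B * C) * (ε / ε ^ p) := by
        rw [Real.mul_rpow hc.le hε0.le]
        field_simp

variable [FiniteDimensional ℝ V] [MeasurableSpace V] [BorelSpace V] {μ : Measure V}
  [μ.IsAddHaarMeasure]

theorem integrableOn_inv_norm_rpow (hp : finrank ℝ V < p) {r : ℝ} (hr : 0 < r) :
    IntegrableOn (fun v : V => (‖v‖ ^ p)⁻¹) {v | r ≤ ‖v‖} μ := by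
  have hp0 : 0 ≤ p := (Nat.cast_nonneg _).trans hp.le
  refine (((integrable_one_add_norm (μ := μ) hp).const_mul ((r⁻¹ + 1) ^ p)).integrableOn).mono'
    (by fun_prop : Measurable _).aestronglyMeasurable ?_
  filter_upwards [ae_restrict_mem (measurableSet_le measurable_const measurable_norm)]
    with v (hv : r ≤ ‖v‖)
  have hv0 : 0 < ‖v‖ := hr.trans_le hv
  have hle : 1 + ‖v‖ ≤ (r⁻¹ + 1) * ‖v‖ := by
    rw [add_one_mul]
    gcongr
    rwa [inv_mul_eq_div, one_le_div hr]
  rw [Real.norm_of_nonneg (by positivity), Real.rpow_neg (by positivity), ← div_eq_mul_inv,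
    inv_eq_one_div, div_le_div_iff₀ (by positivity) (by positivity), one_mul,
    ← Real.mul_rpow (by positivity) hv0.le]
  exact Real.rpow_le_rpow (by positivity) hle hp0

theorem integrableOn_diffQuotient (hg : Integrable g μ) (hp : finrank ℝ V < p) (z : V) {r : ℝ}
    (hr : 0 < r) : IntegrableOn (diffQuotient p g z) {v | r ≤ ‖v‖} μ := by
  have hp0 : 0 ≤ p := (Nat.cast_nonneg _).trans hp.le
  have hbound : ∀ᵐ v ∂μ.restrict {v : V | r ≤ ‖v‖}, ‖(‖v‖ ^ p)⁻¹‖ ≤ (r ^ p)⁻¹ := by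
    filter_upwards [ae_restrict_mem (measurableSet_le measurable_const measurable_norm)]
      with v (hv : r ≤ ‖v‖)
    rw [Real.norm_of_nonneg (by positivity)]
    gcongr
  have hconst := (integrableOn_inv_norm_rpow (μ := μ) hp hr).smul_const (g z)
  have hmeas : Measurable fun v : V => (‖v‖ ^ p)⁻¹ := by fun_prop
  have hshift := (hg.comp_add_left z).integrableOn.bdd_smul _ hmeas.aestronglyMeasurable hbound
  exact (hconst.sub hshift).congr (.of_forall fun v => (smul_sub (‖v‖ ^ p)⁻¹ _ _).symm)

theorem setIntegral_diffQuotient_eq_symmDiffQuotient {S : Set V} {z : V}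
    (hS : Neg.neg ⁻¹' S = S) (hint : IntegrableOn (diffQuotient p g z) S μ) :
    ∫ v in S, diffQuotient p g z v ∂μ =
      (1 / 2 : ℝ) • ∫ v in S, symmDiffQuotient p g z v ∂μ := by
  have hmp := Measure.measurePreserving_neg μ
  have hemb := (MeasurableEquiv.neg V).measurableEmbedding
  have hflip : ∫ v in S, diffQuotient p g z (-v) ∂μ = ∫ v in S, diffQuotient p g z v ∂μ := by
    simpa only [hS] using hmp.setIntegral_preimage_emb hemb (diffQuotient p g z) S
  have hint' : IntegrableOn (fun v => diffQuotient p g z (-v)) S μ := by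
    simpa only [hS, Function.comp_def] using (hmp.integrableOn_comp_preimage hemb).2 hint
  simp only [symmDiffQuotient]
  rw [integral_add hint hint', hflip, ← two_smul ℝ, smul_smul]
  norm_num

theorem IsExcisionGauge.integrableOn_diffQuotient {ρ : V → ℝ} {A : V ≃L[ℝ] V}
    (hρ : IsExcisionGauge ρ A) (hg : Integrable g μ) (hp : finrank ℝ V < p) (z : V) {ε : ℝ}
    (hε : 0 < ε) : IntegrableOn (diffQuotient p g z) {v | ε < ρ v} μ := by
  obtain ⟨r, hr, hsub⟩ := hρ.exists_setOf_lt_subset hε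
  exact (WeightedFractional.integrableOn_diffQuotient hg hp z hr).mono_set hsub

theorem tendsto_setIntegral_diffQuotient_ellipsoid (A : V ≃L[ℝ] V) (hg : Integrable g μ)
    (hp : finrank ℝ V < p) {z : V} (hsymm : Integrable (symmDiffQuotient p g z) μ) :
    Tendsto (fun ε => ∫ v in {v | ε < ‖A v‖}, diffQuotient p g z v ∂μ) (𝓝[>] 0)
      (𝓝 ((1 / 2 : ℝ) • ∫ v, symmDiffQuotient p g z v ∂μ)) := by
  have hgauge := IsExcisionGauge.norm_apply A
  have hpos (v : V) (hv : symmDiffQuotient p g z v ≠ 0) : 0 < ‖A v‖ := by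
    rw [norm_pos_iff, map_ne_zero_iff A A.injective]
    rintro rfl
    simp [symmDiffQuotient, diffQuotient] at hv
  refine ((tendsto_setIntegral_setOf_lt hgauge.measurable hsymm hpos).const_smul
    (1 / 2 : ℝ)).congr' ?_
  filter_upwards [self_mem_nhdsWithin] with ε hε
  exact (setIntegral_diffQuotient_eq_symmDiffQuotient (by ext; simp)
    (hgauge.integrableOn_diffQuotient hg hp z hε)).symm

theorem IsExcisionGauge.tendsto_setIntegral_diffQuotient_sub {ρ : V → ℝ} {A : V ≃L[ℝ] V}
    (hρ : IsExcisionGauge ρ A) (hg : Integrable g μ) {z : V} (hgz : DifferentiableAt ℝ g z)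
    (hp : finrank ℝ V < p) (hp' : p < finrank ℝ V + 2) :
    Tendsto (fun ε => (∫ v in {v | ε < ρ v}, diffQuotient p g z v ∂μ) -
      ∫ v in {v | ε < ‖A v‖}, diffQuotient p g z v ∂μ) (𝓝[>] 0) (𝓝 0) := by
  have hA := norm_apply A
  obtain ⟨D, hD, hsub⟩ := hρ.exists_symmDiff_subset_ellipsoidalShell
  obtain ⟨M, hM0, hM⟩ := exists_norm_diffQuotient_le_of_mem_ellipsoidalShell hgz
    ((Nat.cast_nonneg _).trans hp.le) A D
  obtain ⟨K, hK⟩ := (measureReal_ellipsoidalShell_isBigO A μ hD).bound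
  have hlim : Tendsto (fun ε : ℝ => M * K * ε ^ (finrank ℝ V + 2 - p)) (𝓝[>] 0) (𝓝 0) := by
    have hcont : Continuous fun ε : ℝ => M * K * ε ^ (finrank ℝ V + 2 - p) :=
      continuous_const.mul (Real.continuous_rpow_const (sub_pos.2 hp').le)
    refine tendsto_nhdsWithin_of_tendsto_nhds ?_
    simpa [Real.zero_rpow (sub_pos.2 hp').ne'] using hcont.tendsto 0
  refine squeeze_zero_norm' ?_ hlim
  filter_upwards [self_mem_nhdsWithin, hsub, hM, hK] with ε (hε : 0 < ε) hsub hM hK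
  rw [Real.norm_of_nonneg measureReal_nonneg, Real.norm_of_nonneg (by positivity)] at hK
  have hfin := (isBounded_ellipsoidalShell A D ε).measure_lt_top (μ := μ)
  calc ‖(∫ v in {v | ε < ρ v}, diffQuotient p g z v ∂μ) -
        ∫ v in {v | ε < ‖A v‖}, diffQuotient p g z v ∂μ‖
      ≤ M * (ε / ε ^ p) * μ.real ({v | ε < ρ v} ∆ {v | ε < ‖A v‖}) :=
        norm_setIntegral_sub_setIntegral_le (measurableSet_lt measurable_const hρ.measurable)
          (measurableSet_lt measurable_const hA.measurable)
          (hρ.integrableOn_diffQuotient hg hp z hε) (hA.integrableOn_diffQuotient hg hp z hε)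
          ((measure_mono hsub).trans_lt hfin) fun v hv => hM v (hsub hv)
    _ ≤ M * (ε / ε ^ p) * (K * ε ^ (finrank ℝ V + 1)) := by
        gcongr
        exact (measureReal_mono hsub hfin.ne).trans hK
    _ = M * K * ε ^ (finrank ℝ V + 2 - p) := by
        rw [Real.rpow_sub hε, Real.rpow_add hε, Real.rpow_natCast, Real.rpow_two]
        ring

theorem IsExcisionGauge.tendsto_setIntegral_diffQuotient {ρ : V → ℝ} {A : V ≃L[ℝ] V}
    (hρ : IsExcisionGauge ρ A) (hg : Integrable g μ) {z : V} (hgz : DifferentiableAt ℝ g z)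
    (hp : finrank ℝ V < p) (hp' : p < finrank ℝ V + 2)
    (hsymm : Integrable (symmDiffQuotient p g z) μ) :
    Tendsto (fun ε => ∫ v in {v | ε < ρ v}, diffQuotient p g z v ∂μ) (𝓝[>] 0)
      (𝓝 ((1 / 2 : ℝ) • ∫ v, symmDiffQuotient p g z v ∂μ)) := by
  simpa using (hρ.tendsto_setIntegral_diffQuotient_sub hg hgz hp hp').add
    (tendsto_setIntegral_diffQuotient_ellipsoid A hg hp hsymm)

end PrincipalValue

section Diffeomorphism

variable {E F : Type*} [NormedAddCommGroup E] [NormedSpace ℝ E] [NormedAddCommGroup F]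
  [NormedSpace ℝ F]

theorem isBigO_sub_sub_fderiv_sq {f : E → F} {z : E} (hf : ContDiffAt ℝ 2 f z) :
    (fun v => f (z + v) - f z - fderiv ℝ f z v) =O[𝓝 0] fun v => ‖v‖ ^ 2 := by
  have hf' : DifferentiableAt ℝ (fderiv ℝ f) z :=
    (hf.fderiv_right (m := 1) (by norm_num)).differentiableAt one_ne_zero
  obtain ⟨C, hC, hbound⟩ := hf'.isBigO_sub.exists_pos
  have hdiff : ∀ᶠ y in 𝓝 z, DifferentiableAt ℝ f y :=
    (hf.eventually (by simp)).mono fun y hy => hy.differentiableAt two_ne_zero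
  obtain ⟨r, hr, hball⟩ := Metric.eventually_nhds_iff.1 (hbound.bound.and hdiff)
  refine .of_bound C ?_
  filter_upwards [ball_mem_nhds 0 hr] with v hv
  rw [mem_ball_zero_iff] at hv
  have hlt {y : E} (hy : y ∈ closedBall z ‖v‖) : dist y z < r := (mem_closedBall.1 hy).trans_lt hv
  have hmvt := (convex_closedBall z ‖v‖).norm_image_sub_le_of_norm_fderiv_le' (C := C * ‖v‖)
    (fun y hy => (hball (hlt hy)).2)
    (fun y hy => (hball (hlt hy)).1.trans (by gcongr; simpa [dist_eq_norm] using hy))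
    (mem_closedBall_self (norm_nonneg v)) (y := z + v) (by simp)
  simpa [sq, mul_assoc] using hmvt

theorem exists_hasFDerivAt_symm (φ : E ≃ F) {x : E} (hφ : DifferentiableAt ℝ φ x)
    (hφ_symm : DifferentiableAt ℝ φ.symm (φ x)) :
    ∃ A : F ≃L[ℝ] E, HasFDerivAt φ.symm (A : F →L[ℝ] E) (φ x) := by
  have hleft : (fderiv ℝ φ.symm (φ x)).comp (fderiv ℝ φ x) = .id ℝ E := by
    simpa [Function.comp_def] using (fderiv_comp x hφ_symm hφ).symm
  have hright : (fderiv ℝ φ x).comp (fderiv ℝ φ.symm (φ x)) = .id ℝ F := by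
    have hcomp := fderiv_comp (φ x) (f := φ.symm) (g := φ) (by simpa using hφ) hφ_symm
    simpa [Function.comp_def] using hcomp.symm
  exact ⟨.equivOfInverse (fderiv ℝ φ.symm (φ x)) (fderiv ℝ φ x) (DFunLike.congr_fun hright)
    (DFunLike.congr_fun hleft), hφ_symm.hasFDerivAt⟩

theorem exists_isExcisionGauge_symm [MeasurableSpace E] [BorelSpace E] (φ : E ≃ E) {x : E}
    (hφ : DifferentiableAt ℝ φ x) (hcont : Continuous φ.symm)
    (hφ_symm : ContDiffAt ℝ 2 φ.symm (φ x)) :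
    ∃ A, IsExcisionGauge (fun v => ‖x - φ.symm (φ x + v)‖) A := by
  obtain ⟨A, hA⟩ := exists_hasFDerivAt_symm φ hφ (hφ_symm.differentiableAt two_ne_zero)
  have htaylor := isBigO_sub_sub_fderiv_sq hφ_symm
  simp only [hA.fderiv, φ.symm_apply_apply] at htaylor
  refine ⟨A, by fun_prop, (isBigO_of_le _ fun v => ?_).trans htaylor, fun r hr => ?_⟩
  · rw [norm_sub_rev x]
    exact abs_norm_sub_norm_le _ _
  · obtain ⟨δ, hδ, hclose⟩ := Metric.continuousAt_iff.1 hφ.continuousAt r hr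
    refine ⟨δ, hδ, fun v hv => ?_⟩
    contrapose! hv
    simpa using hclose (x := φ.symm (φ x + v)) (by rwa [dist_comm, dist_eq_norm])

variable [FiniteDimensional ℝ E] [MeasurableSpace E] [BorelSpace E] {θ : E → E} {μ : Measure E}
  [μ.IsAddHaarMeasure] {S : Set E}

theorem integrableOn_preimage_abs_det_fderiv_smul_iff (hθ : Differentiable ℝ θ)
    (hbij : Function.Bijective θ) (hS : MeasurableSet S) (G : E → F) :
    IntegrableOn (fun y => |(fderiv ℝ θ y).det| • G (θ y)) (θ ⁻¹' S) μ ↔ IntegrableOn G S μ := by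
  rw [← integrableOn_image_iff_integrableOn_abs_det_fderiv_smul μ
    (hθ.continuous.measurable hS) (fun y _ => (hθ y).hasFDerivAt.hasFDerivWithinAt)
    hbij.injective.injOn, image_preimage_eq S hbij.surjective]

theorem setIntegral_preimage_abs_det_fderiv_smul (hθ : Differentiable ℝ θ)
    (hbij : Function.Bijective θ) (hS : MeasurableSet S) (G : E → F) :
    ∫ y in θ ⁻¹' S, |(fderiv ℝ θ y).det| • G (θ y) ∂μ = ∫ v in S, G v ∂μ := by
  rw [← integral_image_eq_integral_abs_det_fderiv_smul μ (hθ.continuous.measurable hS)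
    (fun y _ => (hθ y).hasFDerivAt.hasFDerivWithinAt) hbij.injective.injOn,
    image_preimage_eq S hbij.surjective]

end Diffeomorphism

section Conjugation

variable {n : ℕ} {φ : EuclideanSpace ℝ (Fin n) ≃ EuclideanSpace ℝ (Fin n)}
  {w f g : EuclideanSpace ℝ (Fin n) → ℂ} {s : ℝ}

theorem weightedFourier_two_pi_smul (hφ : Differentiable ℝ φ) (hg : ∀ y, g (φ y) = w y * f y)
    (η : EuclideanSpace ℝ (Fin n)) :
    weightedFourier φ w f ((2 * Real.pi) • η) =
      1 / (((2 * Real.pi) ^ ((n : ℝ) / 2) : ℝ) : ℂ) * 𝓕 g η := by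
  rw [weightedFourier, Real.fourier_eq', ← setIntegral_univ (f := fun v => _ • g v),
    ← setIntegral_preimage_abs_det_fderiv_smul hφ φ.bijective .univ, preimage_univ,
    setIntegral_univ]
  congr 2 with y
  have hexp : -Complex.I * ((inner ℝ ((2 * Real.pi) • η) (φ y) : ℝ) : ℂ) =
      ((-2 * Real.pi * inner ℝ (φ y) η : ℝ) : ℂ) * Complex.I := by
    rw [real_inner_smul_left, real_inner_comm]
    push_cast
    ring
  rw [hexp, hg, smul_eq_mul, Complex.real_smul, absJacobian]
  ring

theorem mul_weightedFourierInv {x : EuclideanSpace ℝ (Fin n)} (hwx : w x ≠ 0)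
    (F : EuclideanSpace ℝ (Fin n) → ℂ) :
    w x * weightedFourierInv φ w F x = (((2 * Real.pi) ^ ((n : ℝ) / 2) : ℝ) : ℂ) *
      𝓕⁻ (fun η => F ((2 * Real.pi) • η)) (φ x) := by
  have hpi : 0 < 2 * Real.pi := by positivity
  set c : ℝ := (2 * Real.pi) ^ ((n : ℝ) / 2) with hc
  have hc0 : 0 < c := by positivity
  have hcc : (2 * Real.pi) ^ n = c * c := by
    rw [hc, ← Real.rpow_add hpi, add_halves, Real.rpow_natCast]
  have hexp (η : EuclideanSpace ℝ (Fin n)) :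
      ((2 * Real.pi * inner ℝ η (φ x) : ℝ) : ℂ) * Complex.I =
        Complex.I * ((inner ℝ ((2 * Real.pi) • η) (φ x) : ℝ) : ℂ) := by
    rw [real_inner_smul_left, mul_comm]
  simp only [Real.fourierInv_eq', hexp, smul_eq_mul]
  rw [Measure.integral_comp_smul volume (fun ξ => Complex.exp (Complex.I * (inner ℝ ξ (φ x) : ℝ)) *
    F ξ), finrank_euclideanSpace_fin, hcc, abs_of_pos (by positivity), weightedFourierInv, ← hc,
    Complex.real_smul]
  have hc0' : (c : ℂ) ≠ 0 := by exact_mod_cast hc0.ne'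
  push_cast
  field_simp

theorem mul_weightedFracLaplacian (hφ : Differentiable ℝ φ) (hg : ∀ y, g (φ y) = w y * f y)
    {x : EuclideanSpace ℝ (Fin n)} (hwx : w x ≠ 0) :
    w x * weightedFracLaplacian s φ w f x = fracLaplacian s g (φ x) := by
  have hc : (((2 * Real.pi) ^ ((n : ℝ) / 2) : ℝ) : ℂ) ≠ 0 := by
    exact_mod_cast (by positivity : (2 * Real.pi) ^ ((n : ℝ) / 2) ≠ 0)
  rw [weightedFracLaplacian, mul_weightedFourierInv hwx, fracLaplacian, Real.fourierInv_eq,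
    Real.fourierInv_eq, ← integral_const_mul]
  congr 1 with η
  rw [weightedFourier_two_pi_smul hφ hg, Circle.smul_def, Circle.smul_def, smul_eq_mul,
    smul_eq_mul, Complex.real_smul]
  field_simp

theorem hypersingularIntegrand_eq (hg : ∀ y, g (φ y) = w y * f y)
    (x y : EuclideanSpace ℝ (Fin n)) :
    hypersingularIntegrand s φ w f x y = |(fderiv ℝ (fun y => φ y - φ x) y).det| •
      diffQuotient (n + 2 * s) g (φ x) (φ y - φ x) := by
  rw [hypersingularIntegrand, diffQuotient, add_sub_cancel, hg, hg, norm_sub_rev,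
    fderiv_sub_const, absJacobian, Complex.real_smul, Complex.real_smul]
  push_cast
  ring

theorem hasPrincipalValue_hypersingularIntegrand {ρ : EuclideanSpace ℝ (Fin n) → ℝ}
    {A : EuclideanSpace ℝ (Fin n) ≃L[ℝ] EuclideanSpace ℝ (Fin n)} (hρ : IsExcisionGauge ρ A)
    (hs : s ∈ Ioo (0 : ℝ) 1) (hφ : Differentiable ℝ φ) (hg : ∀ y, g (φ y) = w y * f y)
    (hint : Integrable g) {x : EuclideanSpace ℝ (Fin n)} (hgx : DifferentiableAt ℝ g (φ x))
    (hsymm : Integrable (symmDiffQuotient (n + 2 * s) g (φ x))) :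
    HasPrincipalValue (fun y => ρ (φ y - φ x)) (hypersingularIntegrand s φ w f x)
      ((1 / 2 : ℝ) • ∫ v, symmDiffQuotient (n + 2 * s) g (φ x) v) := by
  have hdim : (finrank ℝ (EuclideanSpace ℝ (Fin n)) : ℝ) = n := by simp
  have hp : finrank ℝ (EuclideanSpace ℝ (Fin n)) < n + 2 * s := by linarith [hs.1]
  have hp' : n + 2 * s < finrank ℝ (EuclideanSpace ℝ (Fin n)) + 2 := by linarith [hs.2]
  have hθ : Differentiable ℝ fun y => φ y - φ x := by fun_prop
  have hbij : Function.Bijective fun y => φ y - φ x :=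
    (Equiv.subRight (φ x)).bijective.comp φ.bijective
  have hmeas (ε : ℝ) : MeasurableSet {v | ε < ρ v} :=
    measurableSet_lt measurable_const hρ.measurable
  rw [funext (hypersingularIntegrand_eq hg x)]
  exact ⟨fun ε hε => (integrableOn_preimage_abs_det_fderiv_smul_iff hθ hbij (hmeas ε) _).2
      (hρ.integrableOn_diffQuotient hint hp _ hε),
    (hρ.tendsto_setIntegral_diffQuotient hint hgx hp hp' hsymm).congr fun ε =>
      (setIntegral_preimage_abs_det_fderiv_smul hθ hbij (hmeas ε) _).symm⟩

end Conjugation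

section Schwartz

variable {V F : Type*} [NormedAddCommGroup V] [NormedSpace ℝ V] [MeasurableSpace V] [BorelSpace V]
  [SecondCountableTopology V] [NormedAddCommGroup F] [NormedSpace ℝ F]

theorem integrable_norm_smul_rpow_smul (μ : Measure V) [μ.HasTemperateGrowth] {p : ℝ} (hp : 0 ≤ p)
    (c : ℝ) (h : 𝓢(V, F)) : Integrable (fun η => ‖c • η‖ ^ p • h η) μ := by
  have hle {t : ℝ} (ht : 0 ≤ t) : t ^ p ≤ 1 + t ^ ⌈p⌉₊ := by
    rcases le_total t 1 with ht1 | ht1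
    · exact (Real.rpow_le_one ht ht1 hp).trans (le_add_of_nonneg_right (by positivity))
    · rw [← Real.rpow_natCast]
      exact (Real.rpow_le_rpow_of_exponent_le ht1 (Nat.le_ceil p)).trans (by linarith)
  have hmeas : Measurable fun η : V => ‖c • η‖ ^ p := by fun_prop
  refine (h.integrable.norm.add ((h.integrable_pow_mul μ ⌈p⌉₊).const_mul (|c| ^ ⌈p⌉₊))).mono'
    (hmeas.aestronglyMeasurable.smul h.continuous.aestronglyMeasurable) (.of_forall fun η => ?_)
  calc ‖‖c • η‖ ^ p • h η‖ ≤ (1 + ‖c • η‖ ^ ⌈p⌉₊) * ‖h η‖ := by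
        rw [norm_smul, Real.norm_of_nonneg (by positivity)]
        gcongr
        exact hle (norm_nonneg _)
    _ = ‖h η‖ + |c| ^ ⌈p⌉₊ * (‖η‖ ^ ⌈p⌉₊ * ‖h η‖) := by
        rw [norm_smul, Real.norm_eq_abs]
        ring

end Schwartz

end WeightedFractional

open WeightedFractional FourierTransform in
theorem mainTheorem7_general (n : ℕ) (s : ℝ) (hs : s ∈ Set.Ioo (0 : ℝ) 1)
    (φ : EuclideanSpace ℝ (Fin n) ≃ EuclideanSpace ℝ (Fin n)) (x : EuclideanSpace ℝ (Fin n))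
    (hφ : Differentiable ℝ φ) (hφ_cont : Continuous φ.symm)
    (hφ_symm : ContDiffAt ℝ 2 φ.symm (φ x))
    (w f g : EuclideanSpace ℝ (Fin n) → ℂ) (hwx : w x ≠ 0) (hg : ∀ y, g (φ y) = w y * f y)
    (hgx : DifferentiableAt ℝ g (φ x)) (hcont : Continuous g) (hint : Integrable g)
    (hint' : Integrable (𝓕 g))
    (hsymb : Integrable fun η => ‖(2 * Real.pi) • η‖ ^ (2 * s) • 𝓕 g η) :
    ∃ L : ℂ,
      HasPrincipalValue (fun y => ‖x - y‖) (hypersingularIntegrand s φ w f x) L ∧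
      HasPrincipalValue (fun y => ‖φ x - φ y‖) (hypersingularIntegrand s φ w f x) L ∧
      weightedFracLaplacian s φ w f x = (fracLaplacianConst n s : ℂ) / w x * L := by
  have hsymm := integrable_symmDiffQuotient hs hcont hint hint' hsymb (φ x)
  have heq := fracLaplacian_eq_integral_symmDiffQuotient hs hcont hint hint' hsymb (φ x)
  rw [finrank_euclideanSpace_fin] at hsymm heq
  obtain ⟨A, hA⟩ := exists_isExcisionGauge_symm φ (hφ x) hφ_cont hφ_symm
  have hid := IsExcisionGauge.norm_apply (.refl ℝ (EuclideanSpace ℝ (Fin n)))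
  refine ⟨(1 / 2 : ℝ) • ∫ v, symmDiffQuotient (n + 2 * s) g (φ x) v, ?_, ?_, ?_⟩
  · simpa using hasPrincipalValue_hypersingularIntegrand hA hs hφ hg hint hgx hsymm
  · simpa [norm_sub_rev] using
      hasPrincipalValue_hypersingularIntegrand hid hs hφ hg hint hgx hsymm
  · rw [← mul_right_inj' hwx, mul_weightedFracLaplacian hφ hg hwx, heq, Complex.real_smul]
    field_simp

theorem mainTheorem7 (n : ℕ) (s : ℝ) (hs : s ∈ Set.Ioo (0 : ℝ) 1)
    (φ : EuclideanSpace ℝ (Fin n) ≃ EuclideanSpace ℝ (Fin n))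
    (hφ : ContDiff ℝ ∞ φ) (hφ_symm : ContDiff ℝ ∞ φ.symm)
    (w : EuclideanSpace ℝ (Fin n) → ℂ) (hw : ContDiff ℝ ∞ w) (hw_ne : ∀ x, w x ≠ 0)
    (f : EuclideanSpace ℝ (Fin n) → ℂ) (hf : f ∈ WeightedFractional.weightedSchwartz φ w)
    (x : EuclideanSpace ℝ (Fin n)) :
    ∃ L : ℂ,
      WeightedFractional.HasPrincipalValue (fun y => ‖x - y‖)
        (WeightedFractional.hypersingularIntegrand s φ w f x) L ∧
      WeightedFractional.HasPrincipalValue (fun y => ‖φ x - φ y‖)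
        (WeightedFractional.hypersingularIntegrand s φ w f x) L ∧
      WeightedFractional.weightedFracLaplacian s φ w f x =
        (WeightedFractional.fracLaplacianConst n s : ℂ) / w x * L := by
  obtain ⟨g, hg⟩ := hf
  exact mainTheorem7_general n s hs φ x (hφ.differentiable (by simp)) hφ_symm.continuous
    (contDiff_infty.1 hφ_symm 2).contDiffAt w f g (hw_ne x)
    (fun y => by simp [hg]) g.differentiableAt g.continuous g.integrable
    (by simpa only [← SchwartzMap.fourier_coe] using SchwartzMap.integrable _)
    (by simpa only [← SchwartzMap.fourier_coe] using
      WeightedFractional.integrable_norm_smul_rpow_smul volume (by linarith [hs.1]) _ _)
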